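/- Let $K$ be a field with algebraic closure $\overline K$, let $R = K[x_1,\dots,x_n]$, and let $f_1,\dots,f_c \in R$ with $c \le n$. For an ideal $I\subseteq R$ let $V(I)\subseteq \overline K^n$ denote the set of common zeros of $I$; the sets $V(I)$ are the closed sets of the ($K$-)Zariski topology of $\overline K^n$. The codimension of an irreducible closed set $Z$ is the supremum of the lengths $d$ of chains $Z = Z_0 \subsetneq Z_1 \subsetneq \dots \subsetneq Z_d$ of irreducible closed subsets of $\overline K^n$. The nondegenerate locus of $f_1,\dots,f_c$ is the union of the irreducible components of $V(\langle f_1,\dots,f_c\rangle)$ that have codimension exactly $c$. For ideals $I, J\subseteq R$ write $I : J = \{p \in R \mid pJ \subseteq I\}$ and $I : J^\infty = \bigcup_{m\ge 0} (I : J^m)$, and write $I : f^\infty$ for $I : \langle f\rangle^\infty$. Consider the following algorithm, in which ideal quotients and saturations are primitive operations. Start with the ideal $J = \langle 0\rangle$ and the empty set $\mathcal K = \varnothing$ of ideals. For $k = 1,\dots,c$ in turn: put $H \leftarrow J : f_k^\infty$; then $\mathcal K \leftarrow \mathcal K \cup \{J : H\}$; then $J \leftarrow H + \langle f_k\rangle$;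 then, for each $K' \in \mathcal K$, one after the other and in any order, $J \leftarrow J : K'^\infty$. Finally return $J$. Theorem. On input $f_1,\dots,f_c$ the algorithm terminates and outputs an ideal $J$, and, whatever the order in which the elements of $\mathcal K$ are visited, the output $J$ satisfies that $V(J)$ is the nondegenerate locus of $f_1,\dots,f_c$. -/

import Mathlib

noncomputable section

namespace NondegenerateLocus

/-- The affine space `Lⁿ`, to be equipped with the Zariski topology of algebraic sets that are
defined over the subfield `K`. -/
def AffineSpace (K L : Type*) (n : ℕ) [Field K] [Field L] [Algebra K L] : Type _ :=
  Fin n → L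

section Geometry

variable {K : Type*} (L : Type*) {n : ℕ} [Field K] [Field L] [Algebra K L]

/-- `V(I)`: the common zeros in `Lⁿ` of the polynomials in `I`, which have coefficients in `K`. -/
def zeros (I : Ideal (MvPolynomial (Fin n) K)) : Set (AffineSpace K L n) :=
  MvPolynomial.zeroLocus L I

theorem zeros_inf (I J : Ideal (MvPolynomial (Fin n) K)) :
    zeros L (I ⊓ J) = zeros L I ∪ zeros L J := by
  apply Set.Subset.antisymm
  · intro x hx
    by_contra h
    have h1 : ¬ ∀ p ∈ I, MvPolynomial.aeval x p = 0 := fun h' => h (Or.inl h')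
    have h2 : ¬ ∀ p ∈ J, MvPolynomial.aeval x p = 0 := fun h' => h (Or.inr h')
    push Not at h1 h2
    obtain ⟨p, hp, hp0⟩ := h1
    obtain ⟨q, hq, hq0⟩ := h2
    have := hx (p * q) ⟨I.mul_mem_right q hp, J.mul_mem_left p hq⟩
    rw [map_mul] at this
    exact (mul_ne_zero hp0 hq0) this
  · rintro x (hx | hx) p hp
    · exact hx p hp.1
    · exact hx p hp.2

theorem zeros_sSup (A : Set (Ideal (MvPolynomial (Fin n) K))) :
    zeros L (sSup A) = ⋂₀ (zeros L '' A) := by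
  apply Set.Subset.antisymm
  · rintro x hx _ ⟨I, hI, rfl⟩ p hp
    exact hx p (le_sSup hI hp)
  · intro x hx
    have h : sSup A ≤ RingHom.ker (MvPolynomial.aeval (R := K) (x : Fin n → L)) :=
      sSup_le fun I hI p hp => hx (zeros L I) ⟨I, hI, rfl⟩ p hp
    exact fun p hp => h hp

/-- The Zariski topology over `K` on `Lⁿ`: the closed sets are the zero sets `V(I)` of the ideals
`I` of `K[x₁, …, xₙ]`. -/
instance : TopologicalSpace (AffineSpace K L n) :=
  TopologicalSpace.ofClosed (Set.range (zeros (K := K) L))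
    ⟨⊤, MvPolynomial.zeroLocus_top⟩
    (fun A hA => by
      refine ⟨sSup (zeros L ⁻¹' A), ?_⟩
      rw [zeros_sSup, Set.image_preimage_eq_of_subset hA])
    (by
      rintro _ ⟨I, rfl⟩ _ ⟨J, rfl⟩
      exact ⟨I ⊓ J, zeros_inf L I J⟩)

variable {L}

/-- `Z` is an irreducible component of `V`: a maximal irreducible closed set contained in `V`. -/
def IsComponent (V : Set (AffineSpace K L n))
    (Z : TopologicalSpace.IrreducibleCloseds (AffineSpace K L n)) : Prop :=
  Maximal (fun W : TopologicalSpace.IrreducibleCloseds (AffineSpace K L n) =>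
    (W : Set (AffineSpace K L n)) ⊆ V) Z

/-- The codimension of an irreducible closed set `Z` of `Lⁿ`: the supremum of the lengths `d` of
the chains `Z = Z₀ ⊊ Z₁ ⊊ ⋯ ⊊ Z_d` of irreducible closed sets. -/
def codim (Z : TopologicalSpace.IrreducibleCloseds (AffineSpace K L n)) : ℕ∞ :=
  Order.coheight Z

variable (L)

/-- The nondegenerate locus of `f₁, …, f_c`: the union of the irreducible components of
`V(f₁, …, f_c)` that have codimension exactly `c`. -/
def nondegenerateLocus {c : ℕ} (f : Fin c → MvPolynomial (Fin n) K) :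
    Set (AffineSpace K L n) :=
  ⋃ Z ∈ {Z : TopologicalSpace.IrreducibleCloseds (AffineSpace K L n) |
      IsComponent (zeros L (Ideal.span (Set.range f))) Z ∧ codim Z = (c : ℕ∞)},
    (Z : Set (AffineSpace K L n))

end Geometry

section Algorithm

variable {R : Type*} [CommRing R]

/-- The quotient ideal `I : J = {p | p J ⊆ I}`. -/
def quot (I J : Ideal R) : Ideal R :=
  Submodule.colon I (J : Set R)

/-- The saturation `I : J^∞`, the union of the increasing sequence `I : J^m`. -/
def sat (I J : Ideal R) : Ideal R :=
  ⨆ m : ℕ, quot I (J ^ m)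

theorem exists_sat_eq [IsNoetherianRing R] (I J : Ideal R) :
    ∃ N : ℕ, ∀ m, N ≤ m → sat I J = quot I (J ^ m) := by
  have hmono : Monotone fun m : ℕ => quot I (J ^ m) := fun _ _ h =>
    Submodule.colon_mono le_rfl (Ideal.pow_le_pow_right h)
  obtain ⟨N, hN⟩ := monotone_stabilizes_iff_noetherian.mpr ‹IsNoetherian R R›
    ⟨fun m : ℕ => quot I (J ^ m), hmono⟩
  refine ⟨N, fun m hm => le_antisymm (iSup_le fun j => ?_) (le_iSup (fun j => quot I (J ^ j)) m)⟩
  have h1 : quot I (J ^ N) = quot I (J ^ m) := hN m hm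
  have h2 : quot I (J ^ N) = quot I (J ^ max m j) := hN _ (hm.trans (le_max_left _ _))
  rw [← h1, h2]
  exact hmono (le_max_right m j)

/-- The states of the algorithm. -/
inductive State (R : Type*) [CommRing R] : Type _
  /-- The head of the outer loop, after `k` completed iterations. -/
  | outer (k : ℕ) (J : Ideal R) (𝒦 : Finset (Ideal R)) : State R
  /-- The inner (cleaning) loop of the iteration with index `k`; `rest` holds the elements of `𝒦`
  that this loop has not visited yet. -/
  | inner (k : ℕ) (J : Ideal R) (𝒦 rest : Finset (Ideal R)) : State R
  /-- The algorithm has returned `J`. -/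
  | returned (J : Ideal R) : State R

/-- The ideal `J` and the empty set `𝒦` with which the algorithm starts. -/
def State.start (R : Type*) [CommRing R] : State R :=
  State.outer 0 ⊥ ∅

open Classical in
/-- One step of the algorithm on input `f₁, …, f_c` (indexed from `0`), quotients and saturations
of ideals being primitive operations. The inner loop visits the elements of `𝒦` in any order. -/
inductive Step {c : ℕ} (f : Fin c → R) : State R → State R → Prop
  /-- `H ← J : f_k^∞`, then `𝒦 ← 𝒦 ∪ {J : H}`, then `J ← H + ⟨f_k⟩`, and the inner loop starts. -/
  | body (k : ℕ) (hk : k < c) (J H : Ideal R) (𝒦 𝒦' : Finset (Ideal R))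
      (hH : H = sat J (Ideal.span {f ⟨k, hk⟩})) (h𝒦 : 𝒦' = 𝒦 ∪ {quot J H}) :
      Step f (State.outer k J 𝒦) (State.inner k (H ⊔ Ideal.span {f ⟨k, hk⟩}) 𝒦' 𝒦')
  /-- `J ← J : K^∞` for a not yet visited element `K` of `𝒦`. -/
  | clean (k : ℕ) (J K : Ideal R) (𝒦 rest : Finset (Ideal R)) (hK : K ∈ rest) :
      Step f (State.inner k J 𝒦 rest) (State.inner k (sat J K) 𝒦 (rest.erase K))
  /-- The inner loop ends. -/
  | next (k : ℕ) (J : Ideal R) (𝒦 : Finset (Ideal R)) :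
      Step f (State.inner k J 𝒦 ∅) (State.outer (k + 1) J 𝒦)
  /-- The outer loop ends after `c` iterations, and `J` is returned. -/
  | ret (J : Ideal R) (𝒦 : Finset (Ideal R)) :
      Step f (State.outer c J 𝒦) (State.returned J)

/-- `s` occurs in some run of the algorithm on input `f`. -/
def Reachable {c : ℕ} (f : Fin c → R) (s : State R) : Prop :=
  Relation.ReflTransGen (Step f) (State.start R) s

/-- The algorithm terminates on input `f`: there is no infinite run, and a run can only stop by
returning an ideal. -/
def Terminates {c : ℕ} (f : Fin c → R) : Prop :=
  (¬ ∃ s : ℕ → State R, s 0 = State.start R ∧ ∀ i, Step f (s i) (s (i + 1))) ∧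
    ∀ s, Reachable f s → (∃ t, Step f s t) ∨ ∃ J, s = State.returned J

/-- Some run of the algorithm on input `f` returns `J`. -/
def Outputs {c : ℕ} (f : Fin c → R) (J : Ideal R) : Prop :=
  Reachable f (State.returned J)

end Algorithm

end NondegenerateLocus

end

/-!
A prime `p` of height `c` that is minimal over `f₁, …, f_c` has a regular, hence Cohen–Macaulay,
local ring, whose maximal ideal is minimal over the `c = dim R_p` images of `f₁, …, f_c`. These
images therefore form a regular sequence, so locally at `p` the saturations `J : f_k^∞` change
nothing: `J` coincides there with `⟨f₁, …, f_k⟩`, no recorded ideal `J : H` is contained in `p`,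
and cleaning does not affect `p`.

Conversely, a prime over `f₁, …, f_k` contains `J` unless it contains one of the recorded ideals,
because `(J : H) H ⊆ J`. Cleaning discards the minimal primes of `J` that contain a recorded ideal,
so that in the end the minimal primes of `J` are minimal over `f₁, …, f_c`. Each iteration raises
the heights of the minimal primes of `J` by at least `1`, since `f_k` lies in no minimal prime of
`J : f_k^∞`; with Krull's height theorem their height is finally `c`.
-/

namespace NondegenerateLocus

section Depth

open IsLocalRing RingTheory.Sequence CategoryTheory Abelian Limits Pointwise

universe u v

variable {A : Type u} [CommRing A] [IsLocalRing A] {M : Type v} [AddCommGroup M] [Module A M]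

variable (A M) in
/-- The depth of the module `M` over the local ring `A` is at least `n`: the maximal ideal contains
an `M`-regular sequence of length `n`. -/
def DepthAtLeast (n : ℕ) : Prop :=
  ∃ rs : List A, rs.length = n ∧ (∀ r ∈ rs, r ∈ maximalIdeal A) ∧ IsRegular M rs

theorem depthAtLeast_iff_subsingleton_ext [Small.{v} A] [IsNoetherianRing A] [Nontrivial M]
    [Module.Finite A M] {n : ℕ} :
    DepthAtLeast A M n ↔ ∀ i < n, Subsingleton
      (Ext (ModuleCat.of A (Shrink.{v} (A ⧸ maximalIdeal A))) (ModuleCat.of A M) i) :=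
  (ModuleCat.exists_isRegular_tfae (maximalIdeal A) n (ModuleCat.of A M)
    (Submodule.top_ne_ideal_smul_of_le_jacobson_annihilator
      (maximalIdeal_le_jacobson _)).symm.lt_top).out 3 1

theorem subsingleton_ext_quotSMulTop {R : Type u} [CommRing R] [Small.{v} R]
    {N M : ModuleCat.{v} R} {x : R} (hx : IsSMulRegular M x) {n : ℕ}
    (h : ∀ i < n + 1, Subsingleton (Ext N M i)) :
    ∀ i < n, Subsingleton (Ext N (ModuleCat.of R (QuotSMulTop x M)) i) := by
  intro i hi
  have ext_isZero (j) (hj : j < n + 1) := AddCommGrpCat.isZero_of_iff_subsingleton.2 (h j hj)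
  exact AddCommGrpCat.subsingleton_of_isZero <| ShortComplex.Exact.isZero_of_both_zeros
    (Ext.covariant_sequence_exact₃' N hx.smulShortComplex_shortExact i (i + 1) rfl)
    ((ext_isZero i (by lia)).eq_zero_of_src _) ((ext_isZero (i + 1) (by lia)).eq_zero_of_tgt _)

/-- Depth is detected by the vanishing of `Ext (A ⧸ 𝔪) M`, so the bound follows from the long exact
sequence of `0 → M → M → M / xM → 0`. -/
theorem DepthAtLeast.quotSMulTop [Small.{v} A] [IsNoetherianRing A] [Module.Finite A M] {n : ℕ}
    (hM : DepthAtLeast A M (n + 1)) {x : A} (hxm : x ∈ maximalIdeal A) (hx : IsSMulRegular M x) :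
    DepthAtLeast A (QuotSMulTop x M) n := by
  have : Nontrivial M := hM.choose_spec.2.2.nontrivial
  have : Nontrivial (QuotSMulTop x M) := nontrivial_quotSMulTop_of_mem_maximalIdeal M hxm
  rw [depthAtLeast_iff_subsingleton_ext] at hM ⊢
  exact subsingleton_ext_quotSMulTop (M := ModuleCat.of A M) hx hM

theorem isSMulRegular_iff_forall_notMem_associatedPrimes {R N : Type*} [CommRing R]
    [IsNoetherianRing R] [AddCommGroup N] [Module R N] {x : R} :
    IsSMulRegular N x ↔ ∀ q ∈ associatedPrimes R N, x ∉ q := by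
  have h : (x ∈ ⋃ q ∈ associatedPrimes R N, (q : Set R)) ↔ x ∈ {r : R | IsSMulRegular N r}ᶜ := by
    rw [biUnion_associatedPrimes_eq_compl_regular]
  simpa using h.not.symm

theorem torsionBySet_eq_smul {R N : Type*} [CommRing R] [AddCommGroup N] [Module R N] {x : R}
    (hx : IsSMulRegular N x) {s : Set R} (h : Submodule.torsionBySet R N s ≤ x • ⊤) :
    Submodule.torsionBySet R N s = x • Submodule.torsionBySet R N s := by
  refine le_antisymm (fun w hw ↦ ?_) (Submodule.smul_le_self_of_tower x _)
  obtain ⟨v, -, rfl⟩ := (Submodule.mem_smul_pointwise_iff_exists _ _ _).1 (h hw)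
  refine Submodule.smul_mem_pointwise_smul _ _ _ ?_
  rw [Submodule.mem_torsionBySet_iff] at hw ⊢
  refine fun a ↦ hx ?_
  simpa only [smul_comm x, smul_zero] using hw a

theorem torsionBySet_ne_bot {R N : Type*} [CommRing R] [IsNoetherianRing R] [AddCommGroup N]
    [Module R N] {q : Ideal R} (hq : q ∈ associatedPrimes R N) :
    Submodule.torsionBySet R N (q : Set R) ≠ ⊥ := by
  obtain ⟨hqp, z, hz⟩ := isAssociatedPrime_iff.1 hq
  intro h
  have hz0 : z = 0 := by
    rw [← Submodule.mem_bot R, ← h, Submodule.mem_torsionBySet_iff]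
    exact fun a ↦ Submodule.mem_colon_singleton.1 (hz.le a.2)
  exact hqp.ne_top (by rw [hz, hz0]; simp)

theorem exists_associatedPrimes_quotSMulTop_lt [IsNoetherianRing A] [Module.Finite A M] {x : A}
    (hxm : x ∈ maximalIdeal A) (hx : IsSMulRegular M x) {q : Ideal A}
    (hq : q ∈ associatedPrimes A M) : ∃ Q ∈ associatedPrimes A (QuotSMulTop x M), q < Q := by
  -- Otherwise the elements killed by `q` form a submodule equal to `x` times itself, contradicting
  -- Nakayama's lemma.
  have not_le : ¬ Submodule.torsionBySet A M (q : Set A) ≤ x • ⊤ := fun h ↦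
    torsionBySet_ne_bot hq <|
      Submodule.eq_bot_of_eq_pointwise_smul_of_mem_jacobson_annihilator
        (IsNoetherian.noetherian _) (torsionBySet_eq_smul hx h) (maximalIdeal_le_jacobson _ hxm)
  obtain ⟨w, hw, hwx⟩ := SetLike.not_le_iff_exists.1 not_le
  have hw0 : (Submodule.Quotient.mk w : QuotSMulTop x M) ≠ 0 := by
    rwa [Ne, Submodule.Quotient.mk_eq_zero]
  obtain ⟨Q, hQ, hle⟩ := exists_le_isAssociatedPrime_of_isNoetherianRing A _ hw0
  refine ⟨Q, hQ, SetLike.lt_iff_le_and_exists.2 ⟨fun a ha ↦ hle ?_, x, hle ?_,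
    isSMulRegular_iff_forall_notMem_associatedPrimes.1 hx q hq⟩⟩
  · rw [Submodule.mem_colon_singleton, ← Submodule.Quotient.mk_smul,
      (Submodule.mem_torsionBySet_iff _ _).1 hw ⟨a, ha⟩]
    exact Submodule.zero_mem _
  · rw [Submodule.mem_colon_singleton, ← Submodule.Quotient.mk_smul, Submodule.mem_bot,
      Submodule.Quotient.mk_eq_zero]
    exact Submodule.smul_mem_pointwise_smul _ _ _ trivial

theorem DepthAtLeast.le_coheight [IsNoetherianRing A] [Module.Finite A M] {n : ℕ}
    (hM : DepthAtLeast A M n) {q : PrimeSpectrum A} (hq : q.asIdeal ∈ associatedPrimes A M) :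
    n ≤ Order.coheight q := by
  obtain ⟨rs, rfl, hrm, hrs⟩ := hM
  induction rs generalizing M q with
  | nil => simp
  | cons x rs ih =>
    obtain ⟨hx, hrs⟩ := (isRegular_cons_iff _ _ _).1 hrs
    obtain ⟨hxm, hrm⟩ := List.forall_mem_cons.1 hrm
    obtain ⟨q', hq', hlt⟩ := exists_associatedPrimes_quotSMulTop_lt hxm hx hq
    have h := ih (q := ⟨q', hq'.isPrime⟩) hq' hrm hrs
    calc ((x :: rs).length : ℕ∞) = rs.length + 1 := by simp
      _ ≤ Order.coheight (⟨q', hq'.isPrime⟩ : PrimeSpectrum A) + 1 := by gcongr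
      _ ≤ Order.coheight q := Order.coheight_add_one_le hlt

theorem coheight_le_supportDim {R N : Type*} [CommRing R] [AddCommGroup N] [Module R N]
    {q : PrimeSpectrum R} (hq : q ∈ Module.support R N) :
    (Order.coheight q : WithBot ℕ∞) ≤ Module.supportDim R N := by
  rw [Order.coheight_eq_krullDim_Ici]
  exact Order.krullDim_le_of_strictMono
    (fun p : Set.Ici q ↦ ⟨p.1, Module.mem_support_mono p.2 hq⟩) fun _ _ h ↦ h

theorem supportDim_le_supportDim_quotient_ofList_add_length [IsNoetherianRing A]
    [Module.Finite A M] {fs : List A} (hfs : ∀ f ∈ fs, f ∈ maximalIdeal A) :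
    Module.supportDim A M ≤
      Module.supportDim A (M ⧸ (Ideal.ofList fs • ⊤ : Submodule A M)) + fs.length := by
  induction fs generalizing M with
  | nil =>
    have e : (M ⧸ (Ideal.ofList ([] : List A) • ⊤ : Submodule A M)) ≃ₗ[A] M :=
      Submodule.quotEquivOfEqBot _ (by simp)
    simp [Module.supportDim_eq_of_equiv e]
  | cons f fs ih =>
    obtain ⟨hf, hfs⟩ := List.forall_mem_cons.1 hfs
    rw [Module.supportDim_eq_of_equiv (Submodule.quotOfListConsSMulTopEquivQuotSMulTopInner M f fs)]
    calc Module.supportDim A M ≤ Module.supportDim A (QuotSMulTop f M) + 1 :=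
          Module.supportDim_le_supportDim_quotSMulTop_succ hf
      _ ≤ _ := by grw [ih hfs]; simp [add_assoc]

theorem DepthAtLeast.isSMulRegular_of_supportDim_lt [IsNoetherianRing A] [Module.Finite A M]
    {n : ℕ} (hM : DepthAtLeast A M n) {f : A}
    (hf : Module.supportDim A (QuotSMulTop f M) < n) : IsSMulRegular M f := by
  refine isSMulRegular_iff_forall_notMem_associatedPrimes.2 fun q hq hfq ↦ hf.not_ge ?_
  have hq' : (⟨q, hq.isPrime⟩ : PrimeSpectrum A) ∈ Module.support A (QuotSMulTop f M) := by
    rw [Module.support_quotSMulTop]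
    refine ⟨Module.mem_support_iff_of_finite.2 ?_, by simpa using hfq⟩
    simpa only [Submodule.annihilator_top] using hq.annihilator_le
  calc (n : WithBot ℕ∞) ≤ Order.coheight (⟨q, hq.isPrime⟩ : PrimeSpectrum A) :=
        mod_cast hM.le_coheight hq
    _ ≤ Module.supportDim A (QuotSMulTop f M) := coheight_le_supportDim hq'

theorem DepthAtLeast.isWeaklyRegular [Small.{v} A] [IsNoetherianRing A] [Module.Finite A M]
    {n d : ℕ} (hM : DepthAtLeast A M n) {fs : List A} (hfs : ∀ f ∈ fs, f ∈ maximalIdeal A)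
    (hd : Module.supportDim A (M ⧸ (Ideal.ofList fs • ⊤ : Submodule A M)) ≤ d)
    (hn : fs.length + d ≤ n) : IsWeaklyRegular M fs := by
  induction fs generalizing M n with
  | nil => exact .nil A M
  | cons f fs ih =>
    obtain ⟨n, rfl⟩ : ∃ k, n = k + 1 := Nat.exists_eq_add_one.2 <| by
      rw [List.length_cons] at hn
      lia
    obtain ⟨hf, hfs⟩ := List.forall_mem_cons.1 hfs
    replace hn : fs.length + d ≤ n := by
      rw [List.length_cons] at hn
      lia
    rw [Module.supportDim_eq_of_equiv
      (Submodule.quotOfListConsSMulTopEquivQuotSMulTopInner M f fs)] at hd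
    have supportDim_lt : Module.supportDim A (QuotSMulTop f M) < (n + 1 : ℕ) := by
      calc Module.supportDim A (QuotSMulTop f M) ≤ d + fs.length := by
            grw [supportDim_le_supportDim_quotient_ofList_add_length hfs, hd]
        _ < (n + 1 : ℕ) := mod_cast by lia
    have hfr := hM.isSMulRegular_of_supportDim_lt supportDim_lt
    exact (isWeaklyRegular_cons_iff _ _ _).2 ⟨hfr, ih (hM.quotSMulTop hf hfr) hfs hd hn⟩

end Depth

section RegularLocalRing

open IsLocalRing RingTheory.Sequence Pointwise

variable {A : Type*} [CommRing A] [IsLocalRing A]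

theorem isLocalRing_quotient_span_singleton {x : A} (hx : x ∈ maximalIdeal A) :
    IsLocalRing (A ⧸ Ideal.span {x}) := by
  have : Nontrivial (A ⧸ Ideal.span {x}) := Ideal.Quotient.nontrivial_iff.2 fun h ↦
    (maximalIdeal.isMaximal A).ne_top (top_le_iff.1 (h ▸ (Ideal.span_singleton_le_iff_mem _).2 hx))
  exact .of_surjective' (Ideal.Quotient.mk _) Ideal.Quotient.mk_surjective

theorem isDomain_of_isPrime_span_singleton [IsNoetherianRing A] {x : A} (hx : x ∈ maximalIdeal A)
    {P Q : PrimeSpectrum A} (hP : P.asIdeal = Ideal.span {x}) (hQP : Q < P) : IsDomain A := by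
  have hxQ : x ∉ Q.asIdeal := fun h ↦
    hQP.not_ge (hP.trans_le ((Ideal.span_singleton_le_iff_mem _).2 h))
  have hQ : Q.asIdeal = x • Q.asIdeal := by
    refine le_antisymm (fun a ha ↦ ?_) (Submodule.smul_le_self_of_tower x _)
    obtain ⟨b, rfl⟩ := Ideal.mem_span_singleton.1 (hP ▸ hQP.le ha)
    exact Submodule.smul_mem_pointwise_smul _ _ _ ((Q.2.mem_or_mem ha).resolve_left hxQ)
  have hQ_bot : Q.asIdeal = ⊥ :=
    Submodule.eq_bot_of_eq_pointwise_smul_of_mem_jacobson_annihilator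
      (IsNoetherian.noetherian _) hQ (maximalIdeal_le_jacobson _ hx)
  have : (⊥ : Ideal A).IsPrime := hQ_bot ▸ Q.2
  exact .of_bot_isPrime A

theorem exists_lt_of_coheight_add_one_le_ringKrullDim [IsNoetherianRing A] {x : A}
    (hx : x ∈ maximalIdeal A) {P : PrimeSpectrum A} (hP : P.asIdeal = Ideal.span {x})
    (hd : (Order.coheight P + 1 : ℕ∞) ≤ ringKrullDim A) : ∃ Q, Q < P := by
  obtain ⟨l, hl, hlen⟩ := (maximalIdeal A).exists_ltSeries_length_eq_height
  -- A longest chain of primes can be moved so that its second prime contains `x`, hence `P`; as `P`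
  -- has no longer chain above it, that prime is `P`.
  obtain ⟨l', hxl, hlen', -, -⟩ := PrimeSpectrum.exist_ltSeries_mem_one_of_mem_last l
    (hl.symm ▸ hx : x ∈ l.last.asIdeal)
  rw [← maximalIdeal_height_eq_ringKrullDim, ← hlen, hlen', WithBot.coe_le_coe] at hd
  have length_pos : 0 < l'.length := Nat.cast_pos.1 (one_pos.trans_le (le_add_self.trans hd))
  have P_le : P ≤ l' 1 := hP.trans_le ((Ideal.span_singleton_le_iff_mem _).2 hxl)
  have length_le : (l'.length : ℕ∞) ≤ Order.coheight (l' 1) + 1 := by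
    grw [← Order.rev_index_le_coheight l' 1]
    norm_cast
    rw [Fin.val_rev, Fin.coe_ofNat_eq_mod, Nat.mod_eq_of_lt (by lia)]
    lia
  have P_eq : P = l' 1 := P_le.eq_of_not_lt fun hlt ↦ by
    have := (length_le.trans (Order.coheight_add_one_le hlt)).trans' hd
    have : Order.coheight P ≠ ⊤ := fun h ↦ by simp [h] at hd
    exact ((ENat.lt_add_one_iff this).2 le_rfl).not_ge ‹_›
  refine ⟨l' 0, P_eq ▸ l'.strictMono (Fin.lt_def.2 ?_)⟩
  simp only [Fin.coe_ofNat_eq_mod, Nat.zero_mod]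
  rw [Nat.mod_eq_of_lt (by lia)]
  exact one_pos

theorem ringKrullDim_quotient_asIdeal {R : Type*} [CommRing R] (P : PrimeSpectrum R) :
    ringKrullDim (R ⧸ P.asIdeal) = Order.coheight P := by
  rw [ringKrullDim_quotient, Order.coheight_eq_krullDim_Ici]
  rfl

theorem isDomain_of_isDomain_quotient_span_singleton [IsNoetherianRing A] {x : A}
    (hx : x ∈ maximalIdeal A) [IsDomain (A ⧸ Ideal.span {x})]
    (hd : ringKrullDim (A ⧸ Ideal.span {x}) + 1 ≤ ringKrullDim A) : IsDomain A := by
  let P : PrimeSpectrum A := ⟨Ideal.span {x}, (Ideal.Quotient.isDomain_iff_prime _).1 ‹_›⟩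
  obtain ⟨Q, hQ⟩ := exists_lt_of_coheight_add_one_le_ringKrullDim hx (P := P) rfl <| by
    simpa only [← ringKrullDim_quotient_asIdeal, WithBot.coe_add, WithBot.coe_one] using hd
  exact isDomain_of_isPrime_span_singleton hx rfl hQ

theorem ringKrullDim_le_length [IsNoetherianRing A] {xs : List A}
    (h : Ideal.ofList xs = maximalIdeal A) : ringKrullDim A ≤ xs.length := by
  classical
  have hmem : maximalIdeal A ∈ (Ideal.span (xs.toFinset : Set A)).minimalPrimes := by
    simp only [List.coe_toFinset, h,
      Ideal.minimalPrimes_eq_subsingleton_self, Set.mem_singleton_iff]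
  rw [← maximalIdeal_height_eq_ringKrullDim]
  exact_mod_cast (Ideal.height_le_card_of_mem_minimalPrimes_span_finset hmem).trans
    (Nat.cast_le.2 xs.toFinset_card_le)

/-- The elements of `xs` generate the maximal ideal of the local ring `A`, and their number is the
dimension of `A`. -/
structure IsRegularSystemOfParameters (xs : List A) : Prop where
  ofList_eq : Ideal.ofList xs = maximalIdeal A
  ringKrullDim_eq : ringKrullDim A = xs.length

namespace IsRegularSystemOfParameters

variable {x : A} {xs : List A}

theorem mem_maximalIdeal (h : IsRegularSystemOfParameters xs) (hx : x ∈ xs) :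
    x ∈ maximalIdeal A :=
  h.ofList_eq ▸ Ideal.subset_span hx

theorem quotient_span_singleton [IsNoetherianRing A] [IsLocalRing (A ⧸ Ideal.span {x})]
    (h : IsRegularSystemOfParameters (x :: xs)) :
    IsRegularSystemOfParameters (xs.map (Ideal.Quotient.mk (Ideal.span {x}))) := by
  have hxs : Ideal.ofList (xs.map (Ideal.Quotient.mk (Ideal.span {x}))) =
      maximalIdeal (A ⧸ Ideal.span {x}) := by
    rw [← map_maximalIdeal_of_surjective _ Ideal.Quotient.mk_surjective, ← h.ofList_eq,
      Ideal.ofList_cons, Ideal.map_sup, Ideal.map_quotient_self, bot_sup_eq, Ideal.map_ofList]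
  refine ⟨hxs, (ringKrullDim_le_length hxs).antisymm ?_⟩
  have hdim := Ideal.height_le_ringKrullDim_quotient_add_one (h.mem_maximalIdeal List.mem_cons_self)
  rw [maximalIdeal_height_eq_ringKrullDim, h.ringKrullDim_eq, List.length_cons, Nat.cast_add]
    at hdim
  rw [List.length_map]
  exact ENat.WithBot.add_le_add_natCast_right_iff.1 hdim

theorem isDomain [IsNoetherianRing A] (h : IsRegularSystemOfParameters xs) : IsDomain A := by
  induction hn : xs.length generalizing A xs with
  | zero =>
    rw [List.length_eq_zero_iff.1 hn] at h
    exact (isField_iff_maximalIdeal_eq.2 (by simp [← h.ofList_eq])).isDomain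
  | succ n ih =>
    obtain ⟨x, xs, rfl⟩ := List.exists_cons_of_length_eq_add_one hn
    have hx := h.mem_maximalIdeal List.mem_cons_self
    have := isLocalRing_quotient_span_singleton hx
    have := ih h.quotient_span_singleton (by simpa using hn)
    refine isDomain_of_isDomain_quotient_span_singleton hx ?_
    rw [h.ringKrullDim_eq, h.quotient_span_singleton.ringKrullDim_eq]
    simp

theorem head_ne_zero [IsNoetherianRing A] (h : IsRegularSystemOfParameters (x :: xs)) : x ≠ 0 := by
  rintro rfl
  have := isLocalRing_quotient_span_singleton (zero_mem (maximalIdeal A))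
  have hdim := h.quotient_span_singleton.ringKrullDim_eq
  rw [Ideal.span_singleton_zero, ringKrullDim_eq_of_ringEquiv (RingEquiv.quotientBot A),
    h.ringKrullDim_eq, List.length_map, List.length_cons] at hdim
  norm_cast at hdim
  lia

theorem isWeaklyRegular [IsNoetherianRing A] (h : IsRegularSystemOfParameters xs) :
    IsWeaklyRegular A xs := by
  induction hn : xs.length generalizing A xs with
  | zero =>
    rw [List.length_eq_zero_iff.1 hn]
    exact .nil A A
  | succ n ih =>
    obtain ⟨x, xs, rfl⟩ := List.exists_cons_of_length_eq_add_one hn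
    have := isLocalRing_quotient_span_singleton (h.mem_maximalIdeal List.mem_cons_self)
    have := h.isDomain
    have hquot := ih h.quotient_span_singleton (by simpa using hn)
    rw [← Ideal.Quotient.algebraMap_eq, isWeaklyRegular_map_algebraMap_iff] at hquot
    let e : QuotSMulTop x A ≃ₗ[A] A ⧸ Ideal.span {x} := Submodule.quotEquivOfEq _ _ <| by
      rw [← Submodule.ideal_span_singleton_smul, smul_eq_mul, Ideal.mul_top]
    exact .cons (IsRegular.of_ne_zero h.head_ne_zero).left.isSMulRegular
      ((e.isWeaklyRegular_congr xs).2 hquot)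

theorem depthAtLeast [IsNoetherianRing A] (h : IsRegularSystemOfParameters xs) :
    DepthAtLeast A A xs.length :=
  ⟨xs, rfl, fun _ ↦ h.mem_maximalIdeal,
    .of_isWeaklyRegular_of_mem_maximalIdeal A (fun _ ↦ h.mem_maximalIdeal) h.isWeaklyRegular⟩

end IsRegularSystemOfParameters

theorem exists_isRegularSystemOfParameters (A : Type*) [CommRing A] [IsRegularLocalRing A] :
    ∃ xs : List A, IsRegularSystemOfParameters xs := by
  obtain ⟨S, hcard, hS⟩ := Submodule.FG.exists_span_finset_card_eq_spanFinrank
    (maximalIdeal A).fg_of_isNoetherianRing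
  refine ⟨S.toList, ?_, ?_⟩
  · simpa [Ideal.ofList] using hS
  · rw [Finset.length_toList, hcard, IsRegularLocalRing.spanFinrank_maximalIdeal]

end RegularLocalRing

section IdealQuotients

variable {R : Type*} [CommRing R] {I J K p : Ideal R}

theorem mem_quot {a : R} : a ∈ quot I J ↔ ∀ b ∈ J, a * b ∈ I :=
  Submodule.mem_colon

theorem le_quot_iff : K ≤ quot I J ↔ K * J ≤ I := by
  simp only [SetLike.le_def, mem_quot, ← Ideal.mul_le]

theorem quot_mul_le (I J : Ideal R) : quot I J * J ≤ I :=
  le_quot_iff.1 le_rfl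

theorem mem_sat {a : R} : a ∈ sat I J ↔ ∃ m, a ∈ quot I (J ^ m) :=
  Submodule.mem_iSup_of_directed _ (Monotone.directed_le fun _ _ h ↦
    Submodule.colon_mono le_rfl (Ideal.pow_le_pow_right h))

theorem le_sat (I J : Ideal R) : I ≤ sat I J := fun _ ha ↦
  mem_sat.2 ⟨0, mem_quot.2 fun b _ ↦ I.mul_mem_right b ha⟩

theorem sat_anti (h : J ≤ K) : sat I K ≤ sat I J :=
  iSup_mono fun m ↦ Submodule.colon_mono le_rfl (Ideal.pow_right_mono h m)

theorem sat_le_of_not_le (hp : p.IsPrime) (hI : I ≤ p) (hJ : ¬ J ≤ p) : sat I J ≤ p :=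
  iSup_le fun m ↦ (hp.mul_le.1 ((quot_mul_le I (J ^ m)).trans hI)).resolve_right
    fun h ↦ hJ (Ideal.IsPrime.le_of_pow_le h)

theorem quot_sat_le [IsNoetherianRing R] (I J : Ideal R) : quot (sat I J) J ≤ sat I J := by
  obtain ⟨N, hN⟩ := exists_sat_eq I J
  calc quot (sat I J) J ≤ quot I (J ^ (N + 1)) := le_quot_iff.2 <| by
        rw [pow_succ', ← mul_assoc]
        grw [quot_mul_le, hN N le_rfl, quot_mul_le]
    _ = sat I J := (hN (N + 1) N.le_succ).symm

theorem not_le_of_mem_minimalPrimes_sat [IsNoetherianRing R] (hp : p ∈ (sat I J).minimalPrimes) :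
    ¬ J ≤ p := by
  intro hJ
  obtain ⟨y, hy⟩ : ∃ y, p = Submodule.colon (sat I J) {y} :=
    Submodule.exists_eq_colon_of_mem_minimalPrimes (x := (1 : R)) <| by
      convert hp using 2
      ext a
      simp [Submodule.mem_colon_singleton]
  have hy_mem : y ∈ sat I J := quot_sat_le I J <| mem_quot.2 fun b hb ↦ by
    rw [mul_comm]
    exact Submodule.mem_colon_singleton.1 (hy.le (hJ hb))
  refine hp.1.1.ne_top ((Ideal.eq_top_iff_one _).2 ?_)
  rwa [hy, Submodule.mem_colon_singleton, one_smul]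

theorem mem_minimalPrimes_of_mem_minimalPrimes_sat [IsNoetherianRing R]
    (hp : p ∈ (sat I J).minimalPrimes) : p ∈ I.minimalPrimes :=
  ⟨⟨hp.1.1, (le_sat I J).trans hp.1.2⟩, fun _ ⟨hq, hIq⟩ hqp ↦ hp.2 ⟨hq, sat_le_of_not_le hq hIq
    fun h ↦ not_le_of_mem_minimalPrimes_sat hp (h.trans hqp)⟩ hqp⟩

theorem add_one_le_height_of_mem_minimalPrimes_sat_sup [IsNoetherianRing R] {k : ℕ∞}
    (hI : ∀ q ∈ I.minimalPrimes, k ≤ q.height) (hp : p ∈ (sat I J ⊔ J).minimalPrimes) :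
    k + 1 ≤ p.height := by
  have := hp.1.1
  obtain ⟨q, hq, hqp⟩ := Ideal.exists_minimalPrimes_le (le_sup_left.trans hp.1.2)
  have := hq.1.1
  have hlt : q < p := lt_of_le_of_ne hqp fun heq ↦
    not_le_of_mem_minimalPrimes_sat hq (heq ▸ le_sup_right.trans hp.1.2)
  calc k + 1 ≤ q.height + 1 := by
        gcongr
        exact hI q (mem_minimalPrimes_of_mem_minimalPrimes_sat hq)
    _ ≤ p.height := Ideal.height_add_one_le_of_lt_of_isPrime hlt

/-- The containment `J_p ⊆ I_p` of the localizations at the prime `p`, spelled out with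
denominators. -/
def LocallyLE (p J I : Ideal R) : Prop :=
  ∀ a ∈ J, ∃ s ∉ p, s * a ∈ I

namespace LocallyLE

theorem of_le (hp : p.IsPrime) (h : J ≤ I) : LocallyLE p J I := fun a ha ↦
  ⟨1, (Ideal.ne_top_iff_one p).1 hp.ne_top, by simpa using h ha⟩

theorem trans_le {I' : Ideal R} (h : LocallyLE p J I) (hI : I ≤ I') : LocallyLE p J I' :=
  fun a ha ↦ (h a ha).imp fun _ hs ↦ ⟨hs.1, hI hs.2⟩

theorem sup_le (hp : p.IsPrime) (hJ : LocallyLE p J I) (hK : LocallyLE p K I) :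
    LocallyLE p (J ⊔ K) I := by
  intro a ha
  obtain ⟨b, hb, d, hd, rfl⟩ := Submodule.mem_sup.1 ha
  obtain ⟨s, hs, hsb⟩ := hJ b hb
  obtain ⟨t, ht, htd⟩ := hK d hd
  refine ⟨s * t, fun h ↦ (hp.mem_or_mem h).elim hs ht, ?_⟩
  rw [mul_add]
  exact add_mem (by simpa only [mul_right_comm] using I.mul_mem_right t hsb)
    (by simpa only [mul_assoc] using I.mul_mem_left s htd)

theorem le (hp : p.IsPrime) (h : LocallyLE p J I) (hI : I ≤ p) : J ≤ p := fun a ha ↦ by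
  obtain ⟨s, hs, hsa⟩ := h a ha
  exact (hp.mem_or_mem (hI hsa)).resolve_left hs

theorem sat_span_singleton_le {x : R} (h : LocallyLE p J I)
    (hx : ∀ s ∉ p, ∀ a, s * (x * a) ∈ I → ∃ t ∉ p, t * a ∈ I) :
    LocallyLE p (sat J (Ideal.span {x})) I := by
  intro a ha
  obtain ⟨m, hm⟩ := mem_sat.1 ha
  obtain ⟨s, hs, hsa⟩ :=
    h _ (mem_quot.1 hm _ (Ideal.pow_mem_pow (Ideal.mem_span_singleton_self x) m))
  clear hm
  induction m generalizing s with
  | zero => exact ⟨s, hs, by simpa using hsa⟩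
  | succ m ih =>
    obtain ⟨t, ht, hta⟩ := hx s hs (a * x ^ m) (by rwa [pow_succ', mul_left_comm a] at hsa)
    exact ih t ht hta

theorem sat_le_of_not_le (hp : p.IsPrime) (h : LocallyLE p J I) (hK : ¬ K ≤ p) :
    LocallyLE p (sat J K) I := by
  obtain ⟨b, hb, hbp⟩ := SetLike.not_le_iff_exists.1 hK
  have h_span : LocallyLE p (sat J (Ideal.span {b})) I :=
    h.sat_span_singleton_le fun s hs a ha ↦
      ⟨s * b, fun hsb ↦ (hp.mem_or_mem hsb).elim hs hbp, by rwa [mul_assoc]⟩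
  exact fun a ha ↦ h_span a (sat_anti ((Ideal.span_singleton_le_iff_mem _).2 hb) ha)

theorem exists_forall_mul_mem (hp : p.IsPrime) (hJ : J.FG) (h : LocallyLE p J I) :
    ∃ s ∉ p, ∀ a ∈ J, s * a ∈ I := by
  classical
  obtain ⟨S, rfl⟩ := hJ
  choose! s hs hsa using h
  refine ⟨∏ a ∈ S, s a, fun hmem ↦ ?_, ?_⟩
  · obtain ⟨a, ha, hap⟩ := hp.prod_mem_iff.1 hmem
    exact hs a (Submodule.subset_span ha) hap
  · have hle : Submodule.span R (S : Set R) ≤ Submodule.colon I {∏ a ∈ S, s a} :=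
      Submodule.span_le.2 fun a ha ↦ Submodule.mem_colon_singleton.2 <| by
        rw [← Finset.mul_prod_erase S s ha, smul_eq_mul, ← mul_assoc, mul_comm a]
        exact I.mul_mem_right _ (hsa a (Submodule.subset_span ha))
    exact fun a ha ↦ by simpa [mul_comm] using Submodule.mem_colon_singleton.1 (hle ha)

theorem not_quot_le (hp : p.IsPrime) (hJ : J.FG) (h : LocallyLE p J I) : ¬ quot I J ≤ p := by
  obtain ⟨s, hs, hsJ⟩ := h.exists_forall_mul_mem hp hJ
  exact fun hle ↦ hs (hle (mem_quot.2 hsJ))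

end LocallyLE

end IdealQuotients

section PrefixIdeal

open IsLocalRing RingTheory.Sequence

variable {R S : Type*} [CommRing R] [CommRing S] {c : ℕ}

/-- The ideal generated by the first `k` of the elements `f₁, …, f_c`. -/
def prefixIdeal (f : Fin c → R) (k : ℕ) : Ideal R :=
  Ideal.ofList ((List.ofFn f).take k)

theorem prefixIdeal_zero (f : Fin c → R) : prefixIdeal f 0 = ⊥ := by
  simp [prefixIdeal]

theorem prefixIdeal_succ (f : Fin c → R) {k : ℕ} (hk : k < c) :
    prefixIdeal f (k + 1) = prefixIdeal f k ⊔ Ideal.span {f ⟨k, hk⟩} := by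
  rw [prefixIdeal, List.take_add_one, Ideal.ofList_append, List.getElem?_eq_getElem (by simpa),
    List.getElem_ofFn, Option.toList_some, Ideal.ofList_singleton, prefixIdeal]

theorem prefixIdeal_self (f : Fin c → R) : prefixIdeal f c = Ideal.span (Set.range f) := by
  rw [prefixIdeal, List.take_of_length_le (List.length_ofFn.le), Ideal.ofList]
  simp [List.mem_ofFn', Set.range]

theorem map_prefixIdeal (φ : R →+* S) (f : Fin c → R) (k : ℕ) :
    (prefixIdeal f k).map φ = prefixIdeal (φ ∘ f) k := by
  rw [prefixIdeal, prefixIdeal, Ideal.map_ofList, List.map_take, List.map_ofFn]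

theorem isWeaklyRegular_of_maximalIdeal_mem_minimalPrimes {A : Type*} [CommRing A]
    [IsRegularLocalRing A] {fs : List A} (h : maximalIdeal A ∈ (Ideal.ofList fs).minimalPrimes)
    (hdim : ringKrullDim A = fs.length) : IsWeaklyRegular A fs := by
  obtain ⟨xs, hxs⟩ := exists_isRegularSystemOfParameters A
  have hlen : xs.length = fs.length := by exact_mod_cast hxs.ringKrullDim_eq.symm.trans hdim
  have dim_quotient_le : ringKrullDim (A ⧸ Ideal.ofList fs) ≤ 0 := by
    have := IsLocalRing.quotient_artinian_of_mem_minimalPrimes_of_isLocalRing _ h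
    exact Ring.krullDimLE_iff.1 inferInstance
  refine hxs.depthAtLeast.isWeaklyRegular (d := 0) (fun f hf ↦ h.1.2 (Ideal.subset_span hf)) ?_
    (by simp [hlen])
  rwa [smul_eq_mul, Ideal.mul_top, Module.supportDim_quotient_eq_ringKrullDim]

/-- `p` is the prime of a nondegenerate component: it is minimal over `f₁, …, f_c` and has
height `c`. -/
structure IsNondegeneratePrime (f : Fin c → R) (p : Ideal R) : Prop where
  mem_minimalPrimes : p ∈ (Ideal.span (Set.range f)).minimalPrimes
  height_eq : p.height = c

namespace IsNondegeneratePrime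

variable {f : Fin c → R} {p : Ideal R}

theorem isPrime (h : IsNondegeneratePrime f p) : p.IsPrime :=
  h.mem_minimalPrimes.1.1

theorem span_le (h : IsNondegeneratePrime f p) : Ideal.span (Set.range f) ≤ p :=
  h.mem_minimalPrimes.1.2

theorem isWeaklyRegular_localization [IsRegularRing R] [p.IsPrime]
    (h : IsNondegeneratePrime f p) :
    IsWeaklyRegular (Localization.AtPrime p) (List.ofFn (algebraMap R (Localization.AtPrime p) ∘ f))
    := by
  refine isWeaklyRegular_of_maximalIdeal_mem_minimalPrimes ?_ ?_
  · have hmap := map_prefixIdeal (algebraMap R (Localization.AtPrime p)) f c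
    rw [prefixIdeal_self, prefixIdeal, List.take_of_length_le List.length_ofFn.le] at hmap
    rw [← hmap, IsLocalization.minimalPrimes_map p.primeCompl]
    simpa only [Set.mem_preimage, IsLocalization.AtPrime.under_maximalIdeal _ p]
      using h.mem_minimalPrimes
  · rw [IsLocalization.AtPrime.ringKrullDim_eq_height p, h.height_eq, List.length_ofFn]
    rfl

theorem exists_mul_mem_prefixIdeal [IsRegularRing R] (h : IsNondegeneratePrime f p) {k : ℕ}
    (hk : k < c) {s a : R} (hs : s ∉ p) (ha : s * (f ⟨k, hk⟩ * a) ∈ prefixIdeal f k) :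
    ∃ t ∉ p, t * a ∈ prefixIdeal f k := by
  have := h.isPrime
  let φ := algebraMap R (Localization.AtPrime p)
  have mem_map_iff (b : R) : φ b ∈ (prefixIdeal f k).map φ ↔
      ∃ t ∉ p, t * b ∈ prefixIdeal f k := by
    simpa using IsLocalization.algebraMap_mem_map_algebraMap_iff p.primeCompl _ (prefixIdeal f k) b
  have regular_mod_prev :=
    h.isWeaklyRegular_localization.regular_mod_prev k (by rwa [List.length_ofFn])
  rw [isSMulRegular_quotient_iff_mem_of_smul_mem, smul_eq_mul, Ideal.mul_top] at regular_mod_prev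
  have hφa : φ (f ⟨k, hk⟩ * a) ∈ (prefixIdeal f k).map φ := (mem_map_iff _).2 ⟨s, hs, ha⟩
  rw [← mem_map_iff]
  rw [map_prefixIdeal] at hφa ⊢
  refine regular_mod_prev _ ?_
  rwa [List.getElem_ofFn, smul_eq_mul, Function.comp_apply, ← map_mul]

end IsNondegeneratePrime

end PrefixIdeal

section Invariant

variable {R : Type*} [CommRing R] {c : ℕ} {f : Fin c → R} {k : ℕ} {J : Ideal R}
  {𝒦 visited : Set (Ideal R)}

/-- The invariant of the algorithm: `k` inputs have been processed into `J`, the ideals in `𝒦` have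
been recorded, and the current cleaning loop has already visited those in `visited`. -/
structure Invariant (f : Fin c → R) (k : ℕ) (J : Ideal R) (𝒦 visited : Set (Ideal R)) :
    Prop where
  prefixIdeal_le : prefixIdeal f k ≤ J
  locallyLE : ∀ p, IsNondegeneratePrime f p → LocallyLE p J (prefixIdeal f k)
  not_le : ∀ p, IsNondegeneratePrime f p → ∀ K ∈ 𝒦, ¬ K ≤ p
  le_or_exists_le : ∀ p : Ideal R, p.IsPrime → prefixIdeal f k ≤ p → J ≤ p ∨ ∃ K ∈ 𝒦, K ≤ p
  le_height : ∀ p ∈ J.minimalPrimes, (k : ℕ∞) ≤ p.height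
  not_le_of_visited : ∀ p ∈ J.minimalPrimes, ∀ K ∈ visited, ¬ K ≤ p

namespace Invariant

theorem start (f : Fin c → R) : Invariant f 0 ⊥ ∅ ∅ where
  prefixIdeal_le := (prefixIdeal_zero f).le
  locallyLE _ hp := .of_le hp.isPrime bot_le
  not_le := by simp
  le_or_exists_le _ _ _ := .inl bot_le
  le_height := by simp
  not_le_of_visited := by simp

theorem clean [IsNoetherianRing R] (h : Invariant f k J 𝒦 visited) {K : Ideal R} (hK : K ∈ 𝒦) :
    Invariant f k (sat J K) 𝒦 (insert K visited) where
  prefixIdeal_le := h.prefixIdeal_le.trans (le_sat J K)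
  locallyLE p hp := (h.locallyLE p hp).sat_le_of_not_le hp.isPrime (h.not_le p hp K hK)
  not_le := h.not_le
  le_or_exists_le p hp hle := by
    by_cases hKp : K ≤ p
    · exact .inr ⟨K, hK, hKp⟩
    · exact (h.le_or_exists_le p hp hle).imp_left (sat_le_of_not_le hp · hKp)
  le_height p hp := h.le_height p (mem_minimalPrimes_of_mem_minimalPrimes_sat hp)
  not_le_of_visited p hp := Set.forall_mem_insert.2 ⟨not_le_of_mem_minimalPrimes_sat hp,
    h.not_le_of_visited p (mem_minimalPrimes_of_mem_minimalPrimes_sat hp)⟩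

theorem locallyLE_sat [IsRegularRing R] (h : Invariant f k J 𝒦 visited) (hk : k < c) {p : Ideal R}
    (hp : IsNondegeneratePrime f p) :
    LocallyLE p (sat J (Ideal.span {f ⟨k, hk⟩})) (prefixIdeal f k) :=
  (h.locallyLE p hp).sat_span_singleton_le fun _ hs _ ↦ hp.exists_mul_mem_prefixIdeal hk hs

theorem body [IsRegularRing R] (h : Invariant f k J 𝒦 visited) (hk : k < c) {H : Ideal R}
    (hH : H = sat J (Ideal.span {f ⟨k, hk⟩})) :
    Invariant f (k + 1) (H ⊔ Ideal.span {f ⟨k, hk⟩}) (insert (quot J H) 𝒦) ∅ := by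
  have hJH : J ≤ H := hH ▸ le_sat _ _
  have locallyLE_H (p) (hp : IsNondegeneratePrime f p) : LocallyLE p H (prefixIdeal f k) :=
    hH ▸ h.locallyLE_sat hk hp
  refine ⟨?_, fun p hp ↦ ?_, fun p hp ↦ Set.forall_mem_insert.2 ⟨?_, h.not_le p hp⟩,
    fun p hp hle ↦ ?_, fun p hp ↦ ?_, by simp⟩
  · rw [prefixIdeal_succ f hk]
    exact sup_le_sup_right (h.prefixIdeal_le.trans hJH) _
  · rw [prefixIdeal_succ f hk]
    exact .sup_le hp.isPrime ((locallyLE_H p hp).trans_le le_sup_left)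
      (.of_le hp.isPrime le_sup_right)
  · exact ((locallyLE_H p hp).trans_le h.prefixIdeal_le).not_quot_le hp.isPrime
      H.fg_of_isNoetherianRing
  · rw [prefixIdeal_succ f hk, sup_le_iff] at hle
    obtain hJ | ⟨K, hK, hKp⟩ := h.le_or_exists_le p hp hle.1
    · obtain hquot | hHp := hp.mul_le.1 ((quot_mul_le J H).trans hJ)
      · exact .inr ⟨_, Set.mem_insert _ _, hquot⟩
      · exact .inl (sup_le hHp hle.2)
    · exact .inr ⟨K, Set.mem_insert_of_mem _ hK, hKp⟩
  · subst hH
    exact_mod_cast add_one_le_height_of_mem_minimalPrimes_sat_sup h.le_height hp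

theorem mem_minimalPrimes_of_isNondegeneratePrime (h : Invariant f c J 𝒦 visited) {p : Ideal R}
    (hp : IsNondegeneratePrime f p) : p ∈ J.minimalPrimes := by
  have hle := h.prefixIdeal_le
  have hlocal := h.locallyLE p hp
  rw [prefixIdeal_self] at hle hlocal
  exact ⟨⟨hp.isPrime, hlocal.le hp.isPrime hp.span_le⟩,
    fun _ ⟨hq, hJq⟩ ↦ hp.mem_minimalPrimes.2 ⟨hq, hle.trans hJq⟩⟩

theorem isNondegeneratePrime_of_mem_minimalPrimes [IsNoetherianRing R] (h : Invariant f c J 𝒦 𝒦)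
    {p : Ideal R} (hp : p ∈ J.minimalPrimes) : IsNondegeneratePrime f p := by
  have hle := h.prefixIdeal_le
  have hor := h.le_or_exists_le
  rw [prefixIdeal_self] at hle hor
  have hp' : p ∈ (Ideal.span (Set.range f)).minimalPrimes := by
    refine ⟨⟨hp.1.1, hle.trans hp.1.2⟩, fun q ⟨hq, hfq⟩ hqp ↦ ?_⟩
    obtain hJ | ⟨K, hK, hKq⟩ := hor q hq hfq
    · exact hp.2 ⟨hq, hJ⟩ hqp
    · exact absurd (hKq.trans hqp) (h.not_le_of_visited p hp K hK)
  refine ⟨hp', le_antisymm ?_ (h.le_height p hp)⟩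
  calc p.height ≤ (Set.range f).ncard :=
        Ideal.height_le_card_of_mem_minimalPrimes_span (Set.finite_range f) hp'
    _ ≤ c := mod_cast (Finite.card_range_le f).trans_eq (Nat.card_fin c)

theorem mem_minimalPrimes_iff [IsNoetherianRing R] (h : Invariant f c J 𝒦 𝒦) {p : Ideal R} :
    p ∈ J.minimalPrimes ↔ IsNondegeneratePrime f p :=
  ⟨h.isNondegeneratePrime_of_mem_minimalPrimes, h.mem_minimalPrimes_of_isNondegeneratePrime⟩

end Invariant

end Invariant

section Algorithm

variable {R : Type*} [CommRing R] {c : ℕ} {f : Fin c → R} {s t : State R}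

/-- The invariant of the states that occur in a run of the algorithm. -/
def State.Invariant (f : Fin c → R) : State R → Prop
  | .outer k J 𝒦 => NondegenerateLocus.Invariant f k J 𝒦 𝒦
  | .inner k J 𝒦 rest => rest ⊆ 𝒦 ∧ NondegenerateLocus.Invariant f (k + 1) J 𝒦 (𝒦 \ rest)
  | .returned J => ∃ 𝒦 : Set (Ideal R), NondegenerateLocus.Invariant f c J 𝒦 𝒦

theorem State.Invariant.step [IsRegularRing R] (hs : s.Invariant f) (h : Step f s t) :
    t.Invariant f := by
  classical
  cases h with
  | body k hk J H 𝒦 𝒦' hH h𝒦 =>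
    subst h𝒦
    refine ⟨subset_rfl, ?_⟩
    simpa using NondegenerateLocus.Invariant.body hs hk hH
  | clean k J K 𝒦 rest hK =>
    refine ⟨(Finset.erase_subset _ _).trans hs.1, ?_⟩
    convert NondegenerateLocus.Invariant.clean hs.2 (hs.1 hK) using 1
    rw [← Finset.coe_sdiff, Finset.sdiff_erase (hs.1 hK), Finset.coe_insert, Finset.coe_sdiff]
  | next k J 𝒦 => simpa [State.Invariant] using hs
  | ret J 𝒦 => exact ⟨_, hs⟩

theorem Reachable.invariant [IsRegularRing R] (h : Reachable f s) : s.Invariant f := by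
  induction h with
  | refl => simpa [State.start, State.Invariant] using NondegenerateLocus.Invariant.start f
  | tail _ hst ih => exact ih.step hst

theorem Outputs.mem_minimalPrimes_iff [IsRegularRing R] {J : Ideal R} (h : Outputs f J)
    {p : Ideal R} : p ∈ J.minimalPrimes ↔ IsNondegeneratePrime f p := by
  obtain ⟨𝒦, hJ⟩ := h.invariant
  exact hJ.mem_minimalPrimes_iff

/-- A measure that decreases with every step of the algorithm. -/
def State.measure (c : ℕ) : State R → ℕ ×ₗ ℕ
  | .outer k _ _ => toLex (2 * (c - k) + 1, 0)
  | .inner k _ _ rest => toLex (2 * (c - (k + 1)) + 2, rest.card)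
  | .returned _ => toLex (0, 0)

theorem Step.measure_lt (h : Step f s t) : t.measure c < s.measure c := by
  classical
  cases h with
  | body k hk J H 𝒦 𝒦' hH h𝒦 => exact Prod.Lex.toLex_lt_toLex.2 (.inl (by dsimp; lia))
  | clean k J K 𝒦 rest hK =>
    exact Prod.Lex.toLex_lt_toLex.2 (.inr ⟨rfl, Finset.card_erase_lt_of_mem hK⟩)
  | next k J 𝒦 => exact Prod.Lex.toLex_lt_toLex.2 (.inl (by dsimp; lia))
  | ret J 𝒦 => exact Prod.Lex.toLex_lt_toLex.2 (.inl (by dsimp; lia))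

/-- The algorithm has completed at most `c` iterations, so it is not stuck at the head of the outer
loop. -/
def State.IsInRange (c : ℕ) : State R → Prop
  | .outer k _ _ => k ≤ c
  | .inner k _ _ _ => k < c
  | .returned _ => True

theorem Step.isInRange (h : Step f s t) (hs : s.IsInRange c) : t.IsInRange c := by
  cases h with
  | body k hk => exact hk
  | clean => exact hs
  | next => exact Nat.succ_le_of_lt hs
  | ret => trivial

theorem Reachable.isInRange (h : Reachable f s) : s.IsInRange c := by
  induction h with
  | refl => exact c.zero_le
  | tail _ hst ih => exact hst.isInRange ih

theorem Reachable.exists_step (h : Reachable f s) : (∃ t, Step f s t) ∨ ∃ J, s = .returned J := by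
  cases s with
  | outer k J 𝒦 =>
    obtain hk | rfl := h.isInRange.lt_or_eq
    · exact .inl ⟨_, .body k hk J _ 𝒦 _ rfl rfl⟩
    · exact .inl ⟨_, .ret J 𝒦⟩
  | inner k J 𝒦 rest =>
    obtain rfl | ⟨K, hK⟩ := rest.eq_empty_or_nonempty
    · exact .inl ⟨_, .next k J 𝒦⟩
    · exact .inl ⟨_, .clean k J K 𝒦 rest hK⟩
  | returned J => exact .inr ⟨J, rfl⟩

theorem terminates (f : Fin c → R) : Terminates f := by
  refine ⟨?_, fun s hs ↦ hs.exists_step⟩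
  rintro ⟨s, -, hs⟩
  obtain ⟨i, hi⟩ := WellFounded.not_rel_apply_succ (r := (· < ·)) fun i ↦ (s i).measure c
  exact hi (hs i).measure_lt

theorem exists_outputs (f : Fin c → R) : ∃ J, Outputs f J := by
  obtain ⟨s, hs, hmin⟩ := exists_minimalFor_of_wellFoundedLT (Reachable f) (State.measure c)
    ⟨_, .refl⟩
  obtain ⟨t, ht⟩ | ⟨J, rfl⟩ := Reachable.exists_step hs
  · exact absurd (hmin (hs.tail ht) ht.measure_lt.le) ht.measure_lt.not_ge
  · exact ⟨J, hs⟩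

end Algorithm

section Geometry

open TopologicalSpace MvPolynomial

variable {K : Type*} (L : Type*) {n : ℕ} [Field K] [Field L] [Algebra K L]
  {I J P : Ideal (MvPolynomial (Fin n) K)} {Z : Set (AffineSpace K L n)}

variable {L} in
theorem isClosed_iff_exists_zeros :
    IsClosed Z ↔ ∃ I : Ideal (MvPolynomial (Fin n) K), zeros L I = Z := by
  rw [← isOpen_compl_iff]
  change Zᶜᶜ ∈ Set.range (zeros L) ↔ _
  rw [compl_compl]
  rfl

theorem isClosed_zeros (I : Ideal (MvPolynomial (Fin n) K)) : IsClosed (zeros L I) :=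
  isClosed_iff_exists_zeros.2 ⟨I, rfl⟩

theorem zeros_anti (h : I ≤ J) : zeros L J ⊆ zeros L I :=
  zeroLocus_anti_mono h

theorem mem_zeros_span_singleton {p : MvPolynomial (Fin n) K} {x : AffineSpace K L n} :
    x ∈ zeros L (Ideal.span {p}) ↔ aeval (x : Fin n → L) p = 0 := by
  rw [zeros, zeroLocus_span]
  exact forall_eq

theorem zeros_vanishingIdeal {L : Type*} [Field L] [Algebra K L] {Z : Set (AffineSpace K L n)}
    (hZ : IsClosed Z) : zeros L (vanishingIdeal K (K := L) (σ := Fin n) Z) = Z := by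
  obtain ⟨I, rfl⟩ := isClosed_iff_exists_zeros.1 hZ
  exact (zeros_anti L (le_vanishingIdeal_zeroLocus I)).antisymm (zeroLocus_vanishingIdeal_le _)

theorem isPrime_vanishingIdeal (hZ : IsIrreducible Z) :
    (vanishingIdeal K (K := L) (σ := Fin n) Z).IsPrime where
  ne_top' h := by
    obtain ⟨x, hx⟩ := hZ.nonempty
    simpa using (Ideal.eq_top_iff_one _).1 h x hx
  mem_or_mem' {p q} hpq := by
    have subset_union : Z ⊆ zeros L (Ideal.span {p}) ∪ zeros L (Ideal.span {q}) := fun x hx ↦ by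
      rw [Set.mem_union, mem_zeros_span_singleton, mem_zeros_span_singleton, ← mul_eq_zero,
        ← map_mul]
      exact hpq x hx
    refine (isPreirreducible_iff_isClosed_union_isClosed.1 hZ.isPreirreducible _ _
      (isClosed_zeros L _) (isClosed_zeros L _) subset_union).imp ?_ ?_ <;>
    exact fun h x hx ↦ (mem_zeros_span_singleton L).1 (h hx)

section IsAlgClosed

variable [IsAlgClosed L]

theorem zeros_subset_zeros_iff [P.IsPrime] : zeros L P ⊆ zeros L I ↔ I ≤ P := by
  refine ⟨fun h ↦ ?_, zeros_anti L⟩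
  rw [← IsPrime.vanishingIdeal_zeroLocus (K := L) P]
  exact le_zeroLocus_iff_le_vanishingIdeal.1 h

theorem isIrreducible_zeros [hP : P.IsPrime] : IsIrreducible (zeros L P) := by
  refine ⟨Set.nonempty_iff_ne_empty.2 fun h ↦ hP.ne_top (top_le_iff.1 ?_), ?_⟩
  · rw [← zeros_subset_zeros_iff L, h]
    exact Set.empty_subset _
  · rw [isPreirreducible_iff_isClosed_union_isClosed]
    rintro Z₁ Z₂ h₁ h₂ h
    obtain ⟨I, rfl⟩ := isClosed_iff_exists_zeros.1 h₁
    obtain ⟨J, rfl⟩ := isClosed_iff_exists_zeros.1 h₂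
    rw [← zeros_inf, zeros_subset_zeros_iff L] at h
    exact (hP.inf_le.1 h).imp (zeros_anti L) (zeros_anti L)

/-- The correspondence `P ↦ V(P)` between the prime ideals of `K[x₁, …, xₙ]` and the irreducible
closed sets of `Lⁿ`, which reverses inclusions. -/
def zerosOrderIso :
    (PrimeSpectrum (MvPolynomial (Fin n) K))ᵒᵈ ≃o IrreducibleCloseds (AffineSpace K L n) where
  toFun P := ⟨zeros L P.ofDual.asIdeal, isIrreducible_zeros L, isClosed_zeros L _⟩
  invFun Z := .toDual ⟨_, isPrime_vanishingIdeal L Z.isIrreducible⟩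
  left_inv P := PrimeSpectrum.ext (IsPrime.vanishingIdeal_zeroLocus P.ofDual.asIdeal)
  right_inv Z := SetLike.coe_injective (zeros_vanishingIdeal Z.isClosed)
  map_rel_iff' := zeros_subset_zeros_iff L

theorem coe_zerosOrderIso (P : (PrimeSpectrum (MvPolynomial (Fin n) K))ᵒᵈ) :
    (zerosOrderIso L P : Set (AffineSpace K L n)) = zeros L P.ofDual.asIdeal :=
  rfl

theorem codim_zerosOrderIso (P : (PrimeSpectrum (MvPolynomial (Fin n) K))ᵒᵈ) :
    codim (zerosOrderIso L P) = P.ofDual.asIdeal.height := by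
  rw [codim, Order.coheight_orderIso, PrimeSpectrum.height_eq_orderHeight]
  rfl

theorem isComponent_zerosOrderIso_iff {P : (PrimeSpectrum (MvPolynomial (Fin n) K))ᵒᵈ} :
    IsComponent (zeros L I) (zerosOrderIso L P) ↔ P.ofDual.asIdeal ∈ I.minimalPrimes := by
  simp only [IsComponent, Maximal, (zerosOrderIso L).surjective.forall, OrderIso.le_iff_le,
    coe_zerosOrderIso, zeros_subset_zeros_iff]
  exact ⟨fun h ↦ ⟨⟨P.ofDual.isPrime, h.1⟩, fun Q hQ ↦ h.2 (.toDual ⟨Q, hQ.1⟩) hQ.2⟩,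
    fun h ↦ ⟨h.1.2, fun Q hQ ↦ h.2 ⟨Q.ofDual.isPrime, hQ⟩⟩⟩

theorem mem_nondegenerateLocus_iff {c : ℕ} {f : Fin c → MvPolynomial (Fin n) K}
    {x : AffineSpace K L n} :
    x ∈ nondegenerateLocus L f ↔ ∃ P, IsNondegeneratePrime f P ∧ x ∈ zeros L P := by
  simp only [nondegenerateLocus, Set.mem_iUnion, Set.mem_ofPred_eq, exists_prop,
    (zerosOrderIso L).surjective.exists, isComponent_zerosOrderIso_iff, codim_zerosOrderIso,
    coe_zerosOrderIso]
  exact ⟨fun ⟨P, ⟨hP, hc⟩, hx⟩ ↦ ⟨_, ⟨hP, hc⟩, hx⟩,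
    fun ⟨P, hP, hx⟩ ↦ ⟨.toDual ⟨P, hP.isPrime⟩, ⟨hP.mem_minimalPrimes, hP.height_eq⟩, hx⟩⟩

end IsAlgClosed

theorem mem_zeros_iff_exists_minimalPrimes {x : AffineSpace K L n} :
    x ∈ zeros L I ↔ ∃ P ∈ I.minimalPrimes, x ∈ zeros L P := by
  refine ⟨fun hx ↦ ?_, fun ⟨P, hP, hx⟩ ↦ zeros_anti L hP.1.2 hx⟩
  have hle : I ≤ RingHom.ker (aeval (R := K) (x : Fin n → L)) := fun p hp ↦ hx p hp
  have := RingHom.ker_isPrime (aeval (R := K) (x : Fin n → L))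
  obtain ⟨P, hP, hPx⟩ := Ideal.exists_minimalPrimes_le hle
  exact ⟨P, hP, fun p hp ↦ hPx hp⟩

end Geometry

end NondegenerateLocus

theorem mainTheorem2_general {K L : Type*} [Field K] [Field L] [Algebra K L] [IsAlgClosed L]
    {n c : ℕ} (f : Fin c → MvPolynomial (Fin n) K) :
    NondegenerateLocus.Terminates f ∧
      (∃ J : Ideal (MvPolynomial (Fin n) K), NondegenerateLocus.Outputs f J) ∧
      ∀ J : Ideal (MvPolynomial (Fin n) K), NondegenerateLocus.Outputs f J →
        NondegenerateLocus.zeros L J = NondegenerateLocus.nondegenerateLocus L f := by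
  refine ⟨NondegenerateLocus.terminates f, NondegenerateLocus.exists_outputs f, fun J hJ ↦ ?_⟩
  ext x
  rw [NondegenerateLocus.mem_zeros_iff_exists_minimalPrimes,
    NondegenerateLocus.mem_nondegenerateLocus_iff]
  simp only [hJ.mem_minimalPrimes_iff]

theorem mainTheorem2 {K L : Type*} [Field K] [Field L] [Algebra K L] [IsAlgClosure K L]
    {n c : ℕ} (hcn : c ≤ n) (f : Fin c → MvPolynomial (Fin n) K) :
    NondegenerateLocus.Terminates f ∧
      (∃ J : Ideal (MvPolynomial (Fin n) K), NondegenerateLocus.Outputs f J) ∧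
      ∀ J : Ideal (MvPolynomial (Fin n) K), NondegenerateLocus.Outputs f J →
        NondegenerateLocus.zeros L J = NondegenerateLocus.nondegenerateLocus L f := by
  have : IsAlgClosed L := IsAlgClosure.isAlgClosed K
  exact mainTheorem2_general f
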